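/- Let $K$ be a field of characteristic $3$ with a derivation $\delta:K\to K$ (an additive map with $\delta(ab)=a\delta(b)+\delta(a)b$), and let $F=\{a\in K \mid \delta(a)=0\}$ be its field of constants. Assume that $\delta$, as an $F$-linear endomorphism of $K$, has minimum polynomial $g(t)=t^3-ct\in F[t]$ with $c\in F$. Let $K[t;\delta]$ be the differential polynomial ring, whose elements are the polynomials $\sum_i a_it^i$ with $a_i\in K$, multiplied by the rule $ta=at+\delta(a)$ for $a\in K$. Let $d\in K\setminus F$ and $f=t^3-ct-d\in K[t;\delta]$. Let $(K,\delta,d)=S_f$ be the set $\{h\in K[t;\delta]\mid \deg h<3\}$ with the usual addition and the multiplication $h\circ k=$ the remainder $r$ of $hk$ under right division by $f$ (that is, $hk=qf+r$ with $\deg r<3$); it is a unital, not necessarily associative $F$-algebra containing $K$ as the constant polynomials. Then: 1. $(K,\delta,d)$ has dimension $9$ over $F$, is not associative, and is a division algebra (it is nonzero, and left and right multiplication with any nonzero element are bijective). 2. Its left nucleus and its middle nucleus are equal to $K$, and its right nucleus contains $K$. (With $[x,y,z]=(xy)z-x(yz)$, these nuclei of an algebra $A$ are the sets of those $x\in A$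 with $[x,A,A]=0$, $[A,x,A]=0$ and $[A,A,x]=0$, respectively.) 3. Put $V(a)=a^3+\delta^2(a)-ca$ for $a\in K$. The set $\{\delta(b)/b\mid b\in K,\ b\neq 0\}$ is an additive subgroup of $K$ and equals $\{a\in K\mid V(a)=0\}$. For each $a\in K$ with $V(a)=0$ the map $G_{\mathrm{id},-a}:\sum_i a_it^i\mapsto\sum_i a_i(t-a)^i$ is an $F$-algebra automorphism of $(K,\delta,d)$; the set $\{G_{\mathrm{id},-a}\mid a\in K,\ V(a)=0\}$ is a subgroup of $\mathrm{Aut}_F((K,\delta,d))$; and $a\mapsto G_{\mathrm{id},-a}$ is a group isomorphism from the additive group $\{\delta(b)/b\mid b\in K,\ b\neq0\}$ onto this subgroup. -/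

import Mathlib

open Polynomial

noncomputable section

/-- The field of constants `{a ∈ K | δ a = 0}` of a derivation `δ` of the field `K`. -/
def constField {K : Type*} [Field K] (δ : Derivation ℤ K K) : Subfield K where
  carrier := {a | δ a = 0}
  mul_mem' {a b} ha hb := by
    have ha' : δ a = 0 := ha
    have hb' : δ b = 0 := hb
    show δ (a * b) = 0
    rw [Derivation.leibniz, ha', hb']; simp
  one_mem' := δ.map_one_eq_zero
  add_mem' {a b} ha hb := by
    have ha' : δ a = 0 := ha
    have hb' : δ b = 0 := hb
    show δ (a + b) = 0
    rw [map_add, ha', hb', add_zero]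
  zero_mem' := map_zero δ
  neg_mem' {a} ha := by
    have ha' : δ a = 0 := ha
    show δ (-a) = 0
    rw [map_neg, ha', neg_zero]
  inv_mem' a ha := by
    have ha' : δ a = 0 := ha
    show δ a⁻¹ = 0
    rw [Derivation.leibniz_inv, ha', smul_zero]

/-- The derivation `δ`, as an endomorphism of the vector space `K` over the field of
constants. -/
def derivationEnd {K : Type*} [Field K] (δ : Derivation ℤ K K) :
    Module.End (constField δ) K where
  toFun := δ
  map_add' := map_add δ
  map_smul' a x := by
    have ha : δ (a : K) = 0 := a.2
    show δ ((a : K) * x) = (a : K) * δ x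
    rw [Derivation.leibniz, ha]; simp

/-! ### The differential polynomial ring `K[t; δ]` -/

/-- The differential polynomial ring `K[t; δ]`. The polynomial with coefficients `aᵢ` represents
`∑ aᵢ tⁱ`, with the coefficients on the left; addition is that of polynomials, and the
multiplication is the one with `t a = a t + δ a` (see `DiffPoly.instRing`). -/
def DiffPoly {K : Type*} [Field K] (_δ : Derivation ℤ K K) : Type _ := K[X]

namespace DiffPoly

variable {K : Type*} [Field K] (δ : Derivation ℤ K K)

instance instAddCommGroup : AddCommGroup (DiffPoly δ) := inferInstanceAs (AddCommGroup K[X])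

instance instModule : Module K (DiffPoly δ) := inferInstanceAs (Module K K[X])

/-- The differential polynomial with a given sequence of coefficients. -/
def ofPoly : K[X] ≃ₗ[K] DiffPoly δ := LinearEquiv.refl K K[X]

/-- The sequence of (left) coefficients of a differential polynomial. -/
def toPoly : DiffPoly δ ≃ₗ[K] K[X] := LinearEquiv.refl K K[X]

/-- Application of `δ` to all coefficients. -/
def coeffDer : K[X] →+ K[X] where
  toFun p := p.sum fun i a => monomial i (δ a)
  map_zero' := by simp
  map_add' p q := Polynomial.sum_add_index _ _ _ (by simp) (by simp)

/-- Left multiplication by `t`, that is `∑ aᵢ tⁱ ↦ ∑ (aᵢ tⁱ⁺¹ + δ(aᵢ) tⁱ)`. -/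
def tMul : AddMonoid.End K[X] := AddMonoidHom.mulRight X + coeffDer δ

/-- Left multiplication by the constant `a`, that is `∑ aᵢ tⁱ ↦ ∑ (a aᵢ) tⁱ`. -/
def coeffMul (a : K) : AddMonoid.End K[X] := AddMonoidHom.mulLeft (C a)

@[simp] theorem coeffMul_apply (a : K) (p : K[X]) : coeffMul a p = C a * p := rfl

theorem end_mul_apply (S T : AddMonoid.End K[X]) (p : K[X]) : (S * T) p = S (T p) := rfl

theorem end_add_apply (S T : AddMonoid.End K[X]) (p : K[X]) : (S + T) p = S p + T p := rfl

/-- Left multiplication by `∑ aᵢ tⁱ`, that is `q ↦ ∑ aᵢ (t (t (⋯ (t q))))`. -/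
def act (p : K[X]) : AddMonoid.End K[X] :=
  p.sum (S := AddMonoid.End K[X]) fun i a => coeffMul a * tMul δ ^ i

variable {δ}

theorem coeffDer_monomial (i : ℕ) (a : K) : coeffDer δ (monomial i a) = monomial i (δ a) := by
  show (monomial i a).sum (fun i a => monomial i (δ a)) = _
  rw [Polynomial.sum_monomial_index]; simp

theorem tMul_monomial (i : ℕ) (a : K) :
    tMul δ (monomial i a) = monomial (i + 1) a + monomial i (δ a) := by
  show monomial i a * X + coeffDer δ _ = _
  rw [coeffDer_monomial, monomial_mul_X]

theorem act_add (p q : K[X]) : act δ (p + q) = act δ p + act δ q := by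
  refine Polynomial.sum_add_index _ _ _ (fun i => ?_) (fun i a b => ?_)
  · ext q; simp
  · ext1 q; simp only [end_add_apply, end_mul_apply, coeffMul_apply, C_add, add_mul]

theorem act_monomial (i : ℕ) (a : K) : act δ (monomial i a) =
    coeffMul a * tMul δ ^ i := by
  unfold act
  rw [Polynomial.sum_monomial_index]
  ext q; simp

theorem act_zero : act δ 0 = 0 := by simp [act]

theorem act_one : act δ 1 = 1 := by
  rw [← monomial_zero_one, act_monomial]
  ext1 q; simp

theorem tMul_pow_one (i : ℕ) : (tMul δ ^ i) 1 = monomial i 1 := by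
  induction i with
  | zero => simp
  | succ i ih =>
    rw [pow_succ', end_mul_apply, ih, tMul_monomial]; simp

theorem act_apply_one (p : K[X]) : act δ p 1 = p := by
  induction p using Polynomial.induction_on' with
  | add p q hp hq => rw [act_add, end_add_apply, hp, hq]
  | monomial i a =>
    rw [act_monomial, end_mul_apply, tMul_pow_one]
    simp [C_mul_monomial]

theorem act_C_mul (a : K) (q : K[X]) :
    act δ (C a * q) = coeffMul a * act δ q := by
  induction q using Polynomial.induction_on' with
  | add p q hp hq => rw [mul_add, act_add, act_add, hp, hq, mul_add]
  | monomial i b =>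
    rw [C_mul_monomial, act_monomial, act_monomial]
    ext1 q; simp [mul_assoc]

theorem tMul_C_mul (b : K) (q : K[X]) :
    tMul δ (C b * q) = C b * tMul δ q + C (δ b) * q := by
  induction q using Polynomial.induction_on' with
  | add p q hp hq => rw [mul_add, map_add, map_add, hp, hq]; ring
  | monomial i a =>
    simp only [C_mul_monomial, tMul_monomial, mul_add, Derivation.leibniz, smul_eq_mul, map_add]
    rw [mul_comm a (δ b)]; abel

theorem act_tMul (q : K[X]) :
    act δ (tMul δ q) = tMul δ * act δ q := by
  induction q using Polynomial.induction_on' with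
  | add p q hp hq => rw [map_add, act_add, act_add, hp, hq, mul_add]
  | monomial i b =>
    rw [tMul_monomial, act_add, act_monomial, act_monomial, act_monomial]
    ext1 q
    simp only [end_add_apply, end_mul_apply, coeffMul_apply,
      tMul_C_mul, pow_succ']

theorem act_act (p q : K[X]) : act δ (act δ p q) = act δ p * act δ q := by
  induction p using Polynomial.induction_on' with
  | add p r hp hr => rw [act_add, end_add_apply, act_add, hp, hr, add_mul]
  | monomial i a =>
    have h : ∀ i : ℕ, act δ ((tMul δ ^ i) q) =
        tMul δ ^ i * act δ q := by
      intro i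
      induction i with
      | zero => simp
      | succ i ih =>
        rw [pow_succ', end_mul_apply, act_tMul, ih, mul_assoc]
    rw [act_monomial, end_mul_apply, coeffMul_apply, act_C_mul, h, mul_assoc]

/-- `(∑ aᵢ tⁱ) q = ∑ aᵢ (t (t (⋯ (t q))))`, where `t (∑ bⱼ tʲ) = ∑ (bⱼ tʲ⁺¹ + δ(bⱼ) tʲ)`. -/
instance instRing : Ring (DiffPoly δ) :=
  { instAddCommGroup δ with
    mul := fun p q => ofPoly δ (act δ (toPoly δ p) (toPoly δ q))
    one := ofPoly δ 1
    left_distrib := fun p q r => map_add (act δ p) q r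
    right_distrib := fun p q r =>
      congrArg (fun S : AddMonoid.End K[X] => S (toPoly δ r)) (act_add (toPoly δ p) (toPoly δ q))
    zero_mul := fun p => congrArg (fun S : AddMonoid.End K[X] => S (toPoly δ p)) (act_zero (δ := δ))
    mul_zero := fun p => map_zero (act δ p)
    mul_assoc := fun p q r =>
      congrArg (fun S : AddMonoid.End K[X] => S (toPoly δ r)) (act_act (toPoly δ p) (toPoly δ q))
    one_mul := fun p => congrArg (fun S : AddMonoid.End K[X] => S (toPoly δ p)) (act_one (δ := δ))
    mul_one := fun p => act_apply_one p
    zsmul := (instAddCommGroup δ).zsmul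
    zsmul_zero' := (instAddCommGroup δ).zsmul_zero'
    zsmul_succ' := (instAddCommGroup δ).zsmul_succ'
    zsmul_neg' := (instAddCommGroup δ).zsmul_neg'
    nsmul := (instAddCommGroup δ).nsmul
    nsmul_zero := (instAddCommGroup δ).nsmul_zero
    nsmul_succ := (instAddCommGroup δ).nsmul_succ }

variable (δ) in
/-- The indeterminate `t`. -/
def t : DiffPoly δ := ofPoly δ X

variable (δ) in
/-- The constant polynomials, `K ⊆ K[t; δ]`. -/
def const : K →+* DiffPoly δ where
  toFun a := ofPoly δ (C a)
  map_one' := rfl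
  map_zero' := C_0
  map_add' _ _ := C_add
  map_mul' a b := by
    show C (a * b) = act δ (C a) (C b)
    rw [C_mul, ← monomial_zero_left, act_monomial]; simp

theorem const_mul (a : K) (p : DiffPoly δ) : const δ a * p = a • p := by
  show act δ (C a) (toPoly δ p) = a • (toPoly δ p)
  rw [← monomial_zero_left, act_monomial]; simp [smul_eq_C_mul]

/-- The defining relation of `K[t; δ]`. -/
theorem t_mul_const (a : K) : t δ * const δ a = const δ a * t δ + const δ (δ a) := by
  rw [const_mul]
  show act δ X (C a) = a • (X : K[X]) + C (δ a)
  rw [← monomial_one_one_eq_X, act_monomial, ← monomial_zero_left, pow_one,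
    end_mul_apply, tMul_monomial]
  simp [smul_monomial]

/-- Every differential polynomial is the sum of its terms `aᵢ tⁱ`. -/
theorem eq_sum (p : DiffPoly δ) :
    p = (toPoly δ p).sum fun i a => const δ a * t δ ^ i := by
  have ht : ∀ i : ℕ, t δ ^ i = ofPoly δ (monomial i 1) := by
    intro i
    induction i with
    | zero => rfl
    | succ i ih =>
      rw [pow_succ', ih]
      show act δ X (monomial i 1) = monomial (i + 1) 1
      rw [← monomial_one_one_eq_X, act_monomial, pow_one, end_mul_apply, tMul_monomial]
      simp
  have h : ∀ (i : ℕ) (a : K), const δ a * t δ ^ i = ofPoly δ (monomial i a) := by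
    intro i a
    rw [const_mul, ht, ← map_smul, smul_monomial, smul_eq_mul, mul_one]
  simp only [h]
  have := map_sum (ofPoly δ) (fun i => monomial i ((toPoly δ p).coeff i)) (toPoly δ p).support
  rw [Polynomial.sum, ← this]
  have h2 := (toPoly δ p).sum_monomial_eq
  rw [Polynomial.sum] at h2
  rw [h2]; rfl

/-- The map `G_{id, b} : ∑ aᵢ tⁱ ↦ ∑ aᵢ (t + b)ⁱ` on `K[t; δ]`. -/
def translate (b : K) (p : DiffPoly δ) : DiffPoly δ :=
  (toPoly δ p).sum fun i a => const δ a * (t δ + const δ b) ^ i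

/-! ### Right division with remainder -/

theorem degree_coeffDer_le (p : K[X]) : (coeffDer δ p).degree ≤ p.degree := by
  refine (degree_sum_le _ _).trans (Finset.sup_le fun i hi => ?_)
  exact (degree_monomial_le _ _).trans (le_degree_of_mem_supp i hi)

theorem tMul_degree_leadingCoeff (p : K[X]) :
    (tMul δ p).degree = p.degree + 1 ∧ (tMul δ p).leadingCoeff = p.leadingCoeff := by
  by_cases hp : p = 0
  · subst hp; simp
  have h1 : (p * X).degree = p.degree + 1 := by rw [degree_mul, degree_X]
  have h2 : (coeffDer δ p).degree < (p * X).degree := by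
    refine (degree_coeffDer_le p).trans_lt ?_
    rw [h1, degree_eq_natDegree hp]
    exact_mod_cast Nat.lt_succ_self _
  have h3 : tMul δ p = p * X + coeffDer δ p := rfl
  rw [h3, degree_add_eq_left_of_degree_lt h2, leadingCoeff_add_of_degree_lt' h2, h1,
    leadingCoeff_mul_X]
  exact ⟨rfl, rfl⟩

theorem act_monomial_degree_leadingCoeff (i : ℕ) {a : K} (ha : a ≠ 0) (p : K[X]) :
    (act δ (monomial i a) p).degree = i + p.degree ∧
      (act δ (monomial i a) p).leadingCoeff = a * p.leadingCoeff := by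
  have h : ((tMul δ ^ i : AddMonoid.End K[X]) p).degree = i + p.degree ∧
      ((tMul δ ^ i : AddMonoid.End K[X]) p).leadingCoeff = p.leadingCoeff := by
    induction i with
    | zero => simp
    | succ i ih =>
      rw [pow_succ', end_mul_apply, (tMul_degree_leadingCoeff _).1,
        (tMul_degree_leadingCoeff _).2, ih.1, ih.2]
      refine ⟨?_, rfl⟩
      push_cast
      rw [add_assoc, add_comm p.degree 1, add_assoc]
  rw [act_monomial, end_mul_apply, coeffMul_apply, degree_C_mul ha, leadingCoeff_mul,
    leadingCoeff_C, h.1, h.2]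
  exact ⟨rfl, rfl⟩

theorem degree_act_le (p q : K[X]) : (act δ p q).degree ≤ p.degree + q.degree := by
  have h : act δ p q = ∑ i ∈ p.support, act δ (monomial i (p.coeff i)) q := by
    conv_lhs => rw [← p.sum_monomial_eq]
    rw [Polynomial.sum]
    induction p.support using Finset.induction_on with
    | empty => rw [Finset.sum_empty, Finset.sum_empty, act_zero]; rfl
    | insert i s hi ih => rw [Finset.sum_insert hi, Finset.sum_insert hi, act_add, end_add_apply, ih]
  rw [h]
  refine (degree_sum_le _ _).trans (Finset.sup_le fun i hi => ?_)
  rw [(act_monomial_degree_leadingCoeff i (mem_support_iff.mp hi) q).1]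
  gcongr
  exact le_degree_of_mem_supp i hi

theorem degree_act (p q : K[X]) : (act δ p q).degree = p.degree + q.degree := by
  by_cases hp : p = 0
  · subst hp; rw [act_zero]; simp
  by_cases hq : q = 0
  · subst hq; simp
  have h1 : act δ p q =
      act δ p.eraseLead q + act δ (monomial p.natDegree p.leadingCoeff) q := by
    rw [← end_add_apply, ← act_add, eraseLead_add_monomial_natDegree_leadingCoeff]
  have h2 := (act_monomial_degree_leadingCoeff (δ := δ) p.natDegree
    (leadingCoeff_ne_zero.mpr hp) q).1
  rw [← degree_eq_natDegree hp] at h2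
  rw [h1, degree_add_eq_right_of_degree_lt, h2]
  rw [h2]
  refine (degree_act_le _ _).trans_lt ?_
  have h3 := degree_eraseLead_lt hp
  rw [degree_eq_natDegree hq]
  exact WithBot.add_lt_add_right (WithBot.coe_ne_bot) h3

theorem exists_division {f : K[X]} (hf : f ≠ 0) (g : K[X]) :
    ∃ q r : K[X], g = act δ q f + r ∧ r.degree < f.natDegree := by
  induction hn : g.natDegree using Nat.strong_induction_on generalizing g with
  | _ n ih =>
    by_cases hg : g.degree < f.natDegree
    · exact ⟨0, g, by rw [act_zero]; exact (zero_add g).symm, hg⟩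
    have hg0 : g ≠ 0 := by
      rintro rfl
      exact hg (by rw [degree_zero]; exact WithBot.bot_lt_coe _)
    have hle : f.natDegree ≤ g.natDegree := by
      rw [degree_eq_natDegree hg0] at hg
      exact_mod_cast not_lt.mp hg
    have ha : g.leadingCoeff / f.leadingCoeff ≠ 0 :=
      div_ne_zero (leadingCoeff_ne_zero.mpr hg0) (leadingCoeff_ne_zero.mpr hf)
    obtain ⟨h1, h2⟩ := act_monomial_degree_leadingCoeff (δ := δ) (g.natDegree - f.natDegree) ha f
    rw [div_mul_cancel₀ _ (leadingCoeff_ne_zero.mpr hf)] at h2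
    rw [degree_eq_natDegree hf, ← Nat.cast_add, Nat.sub_add_cancel hle,
      ← degree_eq_natDegree hg0] at h1
    have h3 := degree_sub_lt_left h1.symm hg0 h2.symm
    set s := monomial (g.natDegree - f.natDegree) (g.leadingCoeff / f.leadingCoeff)
    by_cases h4 : g - act δ s f = 0
    · exact ⟨s, 0, by rw [add_zero]; exact sub_eq_zero.mp h4,
        by rw [degree_zero]; exact WithBot.bot_lt_coe _⟩
    obtain ⟨q, r, hqr, hr⟩ := ih _ (hn ▸ natDegree_lt_natDegree h4 h3) _ rfl
    refine ⟨s + q, r, ?_, hr⟩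
    rw [act_add, end_add_apply, add_assoc, ← hqr]; abel

/-- The space `R_m` of differential polynomials of degree less than `m = deg f`. -/
def lowDegree (f : DiffPoly δ) : Submodule K (DiffPoly δ) :=
  (degreeLT K (toPoly δ f).natDegree).comap (toPoly δ).toLinearMap

theorem eq_zero_of_mul_mem {f q : DiffPoly δ} (hf : f ≠ 0) (h : q * f ∈ lowDegree f) : q = 0 := by
  have hf' : toPoly δ f ≠ 0 := hf
  have h1 : (act δ (toPoly δ q) (toPoly δ f)).degree < (toPoly δ f).natDegree := mem_degreeLT.mp h
  by_contra hq
  have hq' : toPoly δ q ≠ 0 := hq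
  rw [degree_act, degree_eq_natDegree hf', degree_eq_natDegree hq'] at h1
  have h2 : (toPoly δ q).natDegree + (toPoly δ f).natDegree < (toPoly δ f).natDegree := by
    exact_mod_cast h1
  omega

/-- Right division by `f ≠ 0`: every `g` is `q f + r` with a unique `r` of degree less than
`deg f`. -/
theorem existsUnique_remainder {f : DiffPoly δ} (hf : f ≠ 0) (g : DiffPoly δ) :
    ∃! r : lowDegree f, ∃ q : DiffPoly δ, g = q * f + r := by
  obtain ⟨q, r, hqr, hr⟩ := exists_division (δ := δ) (f := toPoly δ f) hf (toPoly δ g)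
  refine ⟨⟨ofPoly δ r, mem_degreeLT.mpr hr⟩, ⟨ofPoly δ q, hqr⟩, ?_⟩
  rintro ⟨r', hr'⟩ ⟨q', hq'⟩
  have h1 : g = ofPoly δ q * f + ofPoly δ r := hqr
  have h2 : (ofPoly δ q - q') * f = r' - ofPoly δ r := by
    rw [sub_mul, sub_eq_sub_iff_add_eq_add, ← h1, hq', add_comm]
  have h3 : ofPoly δ q - q' = 0 := by
    refine eq_zero_of_mul_mem hf ?_
    rw [h2]
    exact (lowDegree f).sub_mem hr' (mem_degreeLT.mpr hr)
  rw [h3, zero_mul] at h2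
  exact Subtype.ext (sub_eq_zero.mp h2.symm)

open Classical in
/-- The remainder of `g` under right division by `f` (and `0` if `f = 0`). -/
def modR (f g : DiffPoly δ) : lowDegree f :=
  if hf : f = 0 then 0 else (existsUnique_remainder hf g).choose

theorem modR_spec {f : DiffPoly δ} (hf : f ≠ 0) (g : DiffPoly δ) :
    ∃ q : DiffPoly δ, g = q * f + modR f g := by
  rw [modR, dif_neg hf]
  exact (existsUnique_remainder hf g).choose_spec.1

theorem modR_eq {f : DiffPoly δ} (hf : f ≠ 0) {g q : DiffPoly δ} {r : lowDegree f}
    (h : g = q * f + r) : modR f g = r :=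
  (existsUnique_remainder hf g).unique (modR_spec hf g) ⟨q, h⟩

theorem modR_add (f g h : DiffPoly δ) : modR f (g + h) = modR f g + modR f h := by
  by_cases hf : f = 0
  · simp [modR, hf]
  obtain ⟨q, hq⟩ := modR_spec hf g
  obtain ⟨q', hq'⟩ := modR_spec hf h
  refine modR_eq hf (q := q + q') ?_
  conv_lhs => rw [hq, hq']
  rw [add_mul, Submodule.coe_add]; abel

theorem modR_smul (f : DiffPoly δ) (a : K) (g : DiffPoly δ) : modR f (a • g) = a • modR f g := by
  by_cases hf : f = 0
  · simp [modR, hf]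
  obtain ⟨q, hq⟩ := modR_spec hf g
  refine modR_eq hf (q := a • q) ?_
  conv_lhs => rw [hq]
  rw [smul_add, ← const_mul a (q * f), ← mul_assoc, const_mul, Submodule.coe_smul]

theorem modR_coe {f : DiffPoly δ} (r : lowDegree f) : modR f (r : DiffPoly δ) = r := by
  by_cases hf : f = 0
  · subst hf
    have h : toPoly δ (r : DiffPoly δ) ∈ degreeLT K (toPoly δ (0 : DiffPoly δ)).natDegree := r.2
    rw [map_zero, natDegree_zero, mem_degreeLT, Nat.cast_zero, ← not_le, zero_le_degree_iff,
      not_not] at h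
    have h' : r = 0 := Subtype.ext h
    rw [h']; simp [modR]
  · exact modR_eq hf (q := 0) (by rw [zero_mul, zero_add])

theorem modR_zero (f : DiffPoly δ) : modR f 0 = 0 := by
  rw [← zero_smul K (0 : DiffPoly δ), modR_smul, zero_smul]

/-- Constants commute with the elements of `K[t; δ]` if they are killed by `δ`. -/
theorem mul_smul_of_mem (a : K) (ha : a ∈ constField δ) (p q : DiffPoly δ) :
    p * (a • q) = a • (p * q) := by
  have ha' : δ a = 0 := ha
  have h : ∀ i : ℕ, ∀ r : K[X], (tMul δ ^ i : AddMonoid.End K[X]) (C a * r) =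
      C a * (tMul δ ^ i : AddMonoid.End K[X]) r := by
    intro i
    induction i with
    | zero => intro r; rfl
    | succ i ih =>
      intro r
      rw [pow_succ', end_mul_apply, ih, tMul_C_mul, ha', C_0, zero_mul, add_zero, end_mul_apply]
  have h2 : ∀ p r : K[X], act δ p (C a * r) = C a * act δ p r := by
    intro p r
    induction p using Polynomial.induction_on' with
    | add p q hp hq => rw [act_add, end_add_apply, end_add_apply, hp, hq, mul_add]
    | monomial i b =>
      rw [act_monomial, end_mul_apply, end_mul_apply, h, coeffMul_apply, coeffMul_apply]; ring
  have h3 := h2 (toPoly δ p) (toPoly δ q)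
  rw [← smul_eq_C_mul, ← smul_eq_C_mul] at h3
  exact h3

end DiffPoly

/-! ### Petit algebras -/

/-- The Petit algebra `S_f`: the space of differential polynomials of degree less than `deg f`,
with the multiplication `g ∘ h = g h mod_r f`. -/
def PetitAlgebra {K : Type*} [Field K] {δ : Derivation ℤ K K} (f : DiffPoly δ) : Type _ :=
  DiffPoly.lowDegree f

namespace PetitAlgebra

open DiffPoly

variable {K : Type*} [Field K] {δ : Derivation ℤ K K} (f : DiffPoly δ)

instance instAddCommGroup : AddCommGroup (PetitAlgebra f) :=
  inferInstanceAs (AddCommGroup (lowDegree f))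

instance instModule : Module K (PetitAlgebra f) := inferInstanceAs (Module K (lowDegree f))

/-- An element of `S_f`, as a differential polynomial. -/
def toDiffPoly : PetitAlgebra f →ₗ[K] DiffPoly δ := (lowDegree f).subtype

/-- The class of a differential polynomial in `S_f`: its remainder under right division by `f`. -/
def mk : DiffPoly δ →ₗ[K] PetitAlgebra f where
  toFun := modR f
  map_add' := modR_add f
  map_smul' := modR_smul f

theorem mk_toDiffPoly (x : PetitAlgebra f) : mk f (toDiffPoly f x) = x := modR_coe x

theorem eq_zero_of_one_notMem (h : (1 : DiffPoly δ) ∉ lowDegree f) (x : PetitAlgebra f) :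
    x = 0 := by
  have hm : (toPoly δ f).natDegree = 0 := by
    by_contra hm
    refine h (mem_degreeLT.mpr ?_)
    show (1 : K[X]).degree < _
    rw [degree_one]
    exact_mod_cast Nat.pos_of_ne_zero hm
  have hx : toPoly δ (toDiffPoly f x) ∈ degreeLT K (toPoly δ f).natDegree := x.2
  rw [hm, mem_degreeLT, Nat.cast_zero, ← not_le, zero_le_degree_iff, not_not] at hx
  exact Subtype.ext hx

theorem mk_one_mul (g : DiffPoly δ) : mk f (toDiffPoly f (mk f 1) * g) = mk f g := by
  by_cases h : (1 : DiffPoly δ) ∈ lowDegree f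
  · have h1 : toDiffPoly f (mk f 1) = 1 :=
      congrArg Subtype.val (modR_coe (⟨1, h⟩ : lowDegree f))
    rw [h1, one_mul]
  · rw [eq_zero_of_one_notMem f h (mk f g), eq_zero_of_one_notMem f h (mk f _)]

instance instNonAssocRing : NonAssocRing (PetitAlgebra f) :=
  { instAddCommGroup f with
    mul := fun g h => mk f (toDiffPoly f g * toDiffPoly f h)
    one := mk f 1
    left_distrib := fun g h k => by
      show mk f (toDiffPoly f g * toDiffPoly f (h + k)) = mk f _ + mk f _
      rw [map_add, mul_add, map_add]
    right_distrib := fun g h k => by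
      show mk f (toDiffPoly f (g + h) * toDiffPoly f k) = mk f _ + mk f _
      rw [map_add, add_mul, map_add]
    zero_mul := fun g => by
      show mk f (toDiffPoly f 0 * toDiffPoly f g) = 0
      rw [map_zero, zero_mul, map_zero]
    mul_zero := fun g => by
      show mk f (toDiffPoly f g * toDiffPoly f 0) = 0
      rw [map_zero, mul_zero, map_zero]
    one_mul := fun g => by
      show mk f (toDiffPoly f (mk f 1) * toDiffPoly f g) = g
      rw [mk_one_mul, mk_toDiffPoly]
    mul_one := fun g => by
      show mk f (toDiffPoly f g * toDiffPoly f (mk f 1)) = g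
      by_cases h : (1 : DiffPoly δ) ∈ lowDegree f
      · have h1 : toDiffPoly f (mk f 1) = 1 :=
          congrArg Subtype.val (modR_coe (⟨1, h⟩ : lowDegree f))
        rw [h1, mul_one, mk_toDiffPoly]
      · rw [eq_zero_of_one_notMem f h g]
        rw [map_zero, zero_mul, map_zero]
    zsmul := (instAddCommGroup f).zsmul
    zsmul_zero' := (instAddCommGroup f).zsmul_zero'
    zsmul_succ' := (instAddCommGroup f).zsmul_succ'
    zsmul_neg' := (instAddCommGroup f).zsmul_neg'
    nsmul := (instAddCommGroup f).nsmul
    nsmul_zero := (instAddCommGroup f).nsmul_zero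
    nsmul_succ := (instAddCommGroup f).nsmul_succ }

theorem mul_def (g h : PetitAlgebra f) : g * h = mk f (toDiffPoly f g * toDiffPoly f h) := rfl

/-- Constants of `δ` can be pulled out of both factors: `S_f` is an algebra over the field of
constants. -/
instance instIsScalarTower :
    IsScalarTower (constField δ) (PetitAlgebra f) (PetitAlgebra f) where
  smul_assoc a g h := by
    show mk f (toDiffPoly f ((a : K) • g) * toDiffPoly f h) =
      (a : K) • mk f (toDiffPoly f g * toDiffPoly f h)
    rw [map_smul, ← const_mul, mul_assoc, const_mul, map_smul]

instance instSMulCommClass :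
    SMulCommClass (constField δ) (PetitAlgebra f) (PetitAlgebra f) where
  smul_comm a g h := by
    show (a : K) • mk f (toDiffPoly f g * toDiffPoly f h) =
      mk f (toDiffPoly f g * toDiffPoly f ((a : K) • h))
    rw [map_smul, mul_smul_of_mem _ a.2, map_smul]

/-- The constant polynomials in `S_f`, that is, the copy of `K` in `S_f`. -/
def constants : Set (PetitAlgebra f) := {x | ∃ a : K, toDiffPoly f x = const δ a}

/-- The automorphism `σ` of `S_f` is the one induced by `G_{id, b}`. -/
def IsTranslation (b : K) (σ : RingAut (PetitAlgebra f)) : Prop :=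
  ∀ x : PetitAlgebra f, toDiffPoly f (σ x) = translate b (toDiffPoly f x)

end PetitAlgebra

/-! ### Nonassociative algebras -/

/-- A nonassociative ring `A ≠ 0` is a division algebra if the left and the right multiplication
with each nonzero element are bijective. -/
def IsDivisionAlg (A : Type*) [NonAssocRing A] : Prop :=
  Nontrivial A ∧ ∀ a : A, a ≠ 0 →
    Function.Bijective (fun x : A => a * x) ∧ Function.Bijective (fun x : A => x * a)

/-- The left nucleus `{x | [x, A, A] = 0}`. -/
def leftNucleus (A : Type*) [NonAssocRing A] : Set A := {x | ∀ y z : A, associator x y z = 0}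

/-- The middle nucleus `{x | [A, x, A] = 0}`. -/
def middleNucleus (A : Type*) [NonAssocRing A] : Set A := {x | ∀ y z : A, associator y x z = 0}

/-- The right nucleus `{x | [A, A, x] = 0}`. -/
def rightNucleus (A : Type*) [NonAssocRing A] : Set A := {x | ∀ y z : A, associator y z x = 0}

/-- The group `Aut_F(A)` of `F`-linear ring automorphisms of `A`. -/
def algAut (F A : Type*) [Field F] [NonAssocRing A] [Module F A] : Subgroup (RingAut A) where
  carrier := {σ | ∀ (a : F) (x : A), σ (a • x) = a • σ x}
  mul_mem' {σ τ} hσ hτ a x := by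
    show σ (τ (a • x)) = a • σ (τ x)
    rw [hτ, hσ]
  one_mem' _ _ := rfl
  inv_mem' {σ} hσ a x := by
    show σ.symm (a • x) = a • σ.symm x
    rw [RingEquiv.symm_apply_eq, hσ, RingEquiv.apply_symm_apply]

/-- The additive group `{δ(b)/b | b ∈ K, b ≠ 0}` of logarithmic derivatives. -/
def logDerivatives {K : Type*} [Field K] (δ : Derivation ℤ K K) : AddSubgroup K where
  carrier := {a | ∃ b : K, b ≠ 0 ∧ a = δ b / b}
  add_mem' := by
    rintro _ _ ⟨b, hb, rfl⟩ ⟨c, hc, rfl⟩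
    refine ⟨b * c, mul_ne_zero hb hc, ?_⟩
    rw [Derivation.leibniz]
    simp only [smul_eq_mul]
    field_simp
    ring
  zero_mem' := ⟨1, one_ne_zero, by simp⟩
  neg_mem' := by
    rintro _ ⟨b, hb, rfl⟩
    refine ⟨b⁻¹, inv_ne_zero hb, ?_⟩
    rw [Derivation.leibniz_inv]
    simp only [smul_eq_mul]
    field_simp

end

/-! Write `F` for the constants and `V(a) = a³ + δ²(a) - c a`. In characteristic three, commuting
with `t³` is `δ³`, and `δ³ = c δ`. So `t³ - c t` is central in `K[t; δ]`, and `f = t³ - c t - d`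
satisfies `f a = a f` and `f t = t f + δ(d)` with `δ(d) ≠ 0` (`cubic_mul_const`, `cubic_mul_t`).

Division algebra: dividing `f` by `t - a` on either side leaves the remainder `V(a) - d`. As `V(a)`
is a constant and `d` is not, `f` has no linear factor. A Euclidean argument then shows that no
product of two nonzero remainders is a left multiple of `f` (`mul_ne_mul_cubic`), and finite
dimension turns injectivity into bijectivity. The dimension is `3 · 3`: Wronskians give `[K : F] ≤
3`, the minimal polynomial gives `≥ 3`.

Nuclei: if `x y = q f + x ∘ y`, then `[x, y, z]` is minus the class of `q f z`. It vanishes for `z ∈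
K`; for `z = t` it is minus the class of `q δ(d)`, so it detects whether `q = 0`.

Automorphisms: `t ↦ t + b` respects the defining relation and sends `f` to `f + V(b)`, hence acts on
`S_f` when `V(b) = 0`. That the zeros of `V` are the logarithmic derivatives comes from `(δ³ - c δ)
b = V(δ b / b) b` and, conversely, from the factorization of `δ³ - c δ` by `δ - a`. -/

/-! ### Cubes and commutators in rings with `3 = 0` -/

/-- Lets a commutation rule act inside right-nested products. -/
theorem mul_mul_of_mul_eq {R : Type*} [Ring R] {u v w z : R} (h : u * v = w * u + z) (x : R) :
    u * (v * x) = w * (u * x) + z * x := by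
  rw [← mul_assoc, h, add_mul, mul_assoc]

/-- Here `b₁`, `b₂` are the iterated commutators of `t` with `b`. Moving every `t` to the right
leaves only these terms and a multiple of `3`. -/
theorem add_pow_three_of_three_eq_zero {R : Type*} [Ring R] (h3 : (3 : R) = 0) {t b b₁ b₂ : R}
    (h0 : t * b = b * t + b₁) (h1 : t * b₁ = b₁ * t + b₂) (hb : b₁ * b = b * b₁) :
    (t + b) ^ 3 = t ^ 3 + b ^ 3 + b₂ := by
  have h : (t + b) ^ 3 = t ^ 3 + b ^ 3 + b₂ +
      3 * (b * (t * t) + b₁ * t + b * (b * t) + b * b₁) := by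
    rw [show (3 : R) = 1 + 1 + 1 by norm_num]
    simp only [pow_succ, pow_zero, one_mul, add_mul, mul_add, mul_assoc, h0, h1, hb,
      mul_mul_of_mul_eq h0]
    abel
  rw [h, h3, zero_mul, add_zero]

/-- The Leibniz rule for `t³ b`: the two middle binomial coefficients are `3`. -/
theorem pow_three_mul_of_three_eq_zero {R : Type*} [Ring R] (h3 : (3 : R) = 0) {t b b₁ b₂ b₃ : R}
    (h0 : t * b = b * t + b₁) (h1 : t * b₁ = b₁ * t + b₂) (h2 : t * b₂ = b₂ * t + b₃) :
    t ^ 3 * b = b * t ^ 3 + b₃ := by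
  have h : t ^ 3 * b = b * t ^ 3 + b₃ + 3 * (b₁ * (t * t) + b₂ * t) := by
    rw [show (3 : R) = 1 + 1 + 1 by norm_num]
    simp only [pow_succ, pow_zero, one_mul, add_mul, mul_add, mul_assoc, h0, h1, h2,
      mul_mul_of_mul_eq h0, mul_mul_of_mul_eq h1]
    abel
  rw [h, h3, zero_mul, add_zero]

/-! ### Degrees and linear polynomials in `K[t; δ]` -/

namespace DiffPoly

variable {K : Type*} [Field K] {δ : Derivation ℤ K K}

theorem toPoly_mul (p q : DiffPoly δ) : toPoly δ (p * q) = act δ (toPoly δ p) (toPoly δ q) := rfl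

theorem toPoly_t : toPoly δ (t δ) = X := rfl

theorem toPoly_const (a : K) : toPoly δ (const δ a) = C a := rfl

theorem const_injective : Function.Injective (const δ) := fun _ _ h => C_injective h

instance instNoZeroDivisors : NoZeroDivisors (DiffPoly δ) where
  eq_zero_or_eq_zero_of_mul_eq_zero {p q} h := by
    have h1 : (toPoly δ p).degree + (toPoly δ q).degree = ⊥ := by
      rw [← degree_act, ← toPoly_mul, h, map_zero, degree_zero]
    rw [WithBot.add_eq_bot, degree_eq_bot, degree_eq_bot] at h1
    exact h1

theorem degree_toPoly_mul (p q : DiffPoly δ) :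
    (toPoly δ (p * q)).degree = (toPoly δ p).degree + (toPoly δ q).degree :=
  degree_act _ _

theorem toPoly_ne_zero {p : DiffPoly δ} (hp : p ≠ 0) : toPoly δ p ≠ 0 := hp

theorem natDegree_toPoly_mul {p q : DiffPoly δ} (hp : p ≠ 0) (hq : q ≠ 0) :
    (toPoly δ (p * q)).natDegree = (toPoly δ p).natDegree + (toPoly δ q).natDegree := by
  have h := degree_toPoly_mul p q
  rw [degree_eq_natDegree (toPoly_ne_zero hp), degree_eq_natDegree (toPoly_ne_zero hq),
    degree_eq_natDegree (toPoly_ne_zero (mul_ne_zero hp hq))] at h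
  exact_mod_cast h

theorem eq_const_of_natDegree_eq_zero {p : DiffPoly δ} (h : (toPoly δ p).natDegree = 0) :
    ∃ a, p = const δ a :=
  ⟨_, (eq_C_of_natDegree_eq_zero h : toPoly δ p = C _)⟩

theorem t_mul_const_mul (a : K) (p : DiffPoly δ) :
    t δ * (const δ a * p) = const δ a * (t δ * p) + const δ (δ a) * p := by
  rw [← mul_assoc, t_mul_const, add_mul, mul_assoc]

theorem eq_mul_sub_of_natDegree_eq_one {p : DiffPoly δ} (h : (toPoly δ p).natDegree = 1) :
    ∃ u a : K, p = const δ u * (t δ - const δ a) := by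
  obtain ⟨u, hu, b, hb⟩ := natDegree_eq_one.mp h
  refine ⟨u, -(b / u), ?_⟩
  have : p = const δ u * t δ + const δ b := by
    rw [const_mul]
    refine (toPoly δ).injective ?_
    rw [map_add, map_smul, toPoly_t, toPoly_const, ← hb, smul_eq_C_mul]
  rw [this, mul_sub, ← map_mul, mul_neg, mul_div_cancel₀ _ hu, map_neg, sub_neg_eq_add]

theorem eq_sub_mul_of_natDegree_eq_one {p : DiffPoly δ} (h : (toPoly δ p).natDegree = 1) :
    ∃ u a : K, p = (t δ - const δ a) * const δ u := by
  obtain ⟨u, a, rfl⟩ := eq_mul_sub_of_natDegree_eq_one h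
  have hu : u ≠ 0 := by
    rintro rfl
    rw [map_zero, zero_mul, map_zero, natDegree_zero] at h
    exact zero_ne_one h
  -- Since `u t = t u - δ u`, moving `u` to the right shifts the root by `δ u / u`.
  refine ⟨u, a + δ u / u, ?_⟩
  rw [sub_mul, t_mul_const, mul_sub, ← map_mul, ← map_mul, add_mul, div_mul_cancel₀ _ hu, map_add,
    mul_comm u a]
  abel

theorem natDegree_t_sub_const (a : K) : (toPoly δ (t δ - const δ a)).natDegree = 1 :=
  natDegree_X_sub_C a

theorem t_sub_const_ne_zero (a : K) : t δ - const δ a ≠ 0 := X_sub_C_ne_zero a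

/-! ### Translations -/

theorem toPoly_t_pow (n : ℕ) : toPoly δ (t δ ^ n) = X ^ n := by
  induction n with
  | zero => rfl
  | succ n ih =>
    rw [pow_succ', toPoly_mul, ih, toPoly_t, X_pow_eq_monomial, ← monomial_one_one_eq_X,
      act_monomial, pow_one, end_mul_apply, tMul_monomial]
    simp

theorem toPoly_const_mul_t_pow (a : K) (n : ℕ) :
    toPoly δ (const δ a * t δ ^ n) = monomial n a := by
  rw [const_mul, map_smul, toPoly_t_pow, smul_X_eq_monomial]

theorem induction_on {P : DiffPoly δ → Prop} (p : DiffPoly δ)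
    (add : ∀ p q, P p → P q → P (p + q)) (monomial : ∀ n a, P (const δ a * t δ ^ n)) : P p := by
  rw [eq_sum p, Polynomial.sum]
  refine Finset.sum_induction _ P add ?_ fun i _ => monomial _ _
  simpa using monomial 0 0

theorem translate_add (b : K) (p q : DiffPoly δ) :
    translate b (p + q) = translate b p + translate b q :=
  Polynomial.sum_add_index _ _ _ (by simp) (by simp [add_mul])

theorem translate_monomial (b a : K) (n : ℕ) :
    translate b (const δ a * t δ ^ n) = const δ a * (t δ + const δ b) ^ n := by
  rw [translate, toPoly_const_mul_t_pow, Polynomial.sum_monomial_index]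
  simp

theorem translate_const (b a : K) : translate b (const δ a) = const δ a := by
  simpa using translate_monomial (δ := δ) b a 0

theorem translate_t (b : K) : translate b (t δ) = t δ + const δ b := by
  simpa using translate_monomial (δ := δ) b 1 1

theorem translate_const_mul (b a : K) (p : DiffPoly δ) :
    translate b (const δ a * p) = const δ a * translate b p := by
  induction p using induction_on with
  | add p q hp hq => rw [mul_add, translate_add, translate_add, hp, hq, mul_add]
  | monomial n e => rw [← mul_assoc, ← map_mul, translate_monomial, translate_monomial, map_mul,
      mul_assoc]

theorem translate_t_mul (b : K) (p : DiffPoly δ) :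
    translate b (t δ * p) = (t δ + const δ b) * translate b p := by
  induction p using induction_on with
  | add p q hp hq => rw [mul_add, translate_add, translate_add, hp, hq, mul_add]
  | monomial n e =>
    rw [t_mul_const_mul, ← pow_succ', translate_add, translate_monomial, translate_monomial,
      translate_monomial, add_mul, t_mul_const_mul, ← mul_assoc (const δ b), ← map_mul, mul_comm b e,
      map_mul, mul_assoc, pow_succ', add_mul, mul_add]
    abel

/-- As `b` commutes with `K`, the element `t + b` obeys the same relation as `t`; so it suffices to
treat left multiplication by constants and by `t`. -/
theorem translate_mul (b : K) (p q : DiffPoly δ) :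
    translate b (p * q) = translate b p * translate b q := by
  induction p using induction_on with
  | add p r hp hr => rw [add_mul, translate_add, translate_add, hp, hr, add_mul]
  | monomial n e =>
    rw [mul_assoc, translate_const_mul, translate_monomial, mul_assoc]
    congr 1
    induction n with
    | zero => simp
    | succ n ih => rw [pow_succ', mul_assoc, translate_t_mul, ih, pow_succ', mul_assoc]

/-- The map `G_{id, b}` as a ring endomorphism of `K[t; δ]`. -/
noncomputable def translateHom (b : K) : DiffPoly δ →+* DiffPoly δ where
  toFun := translate b
  map_one' := by simpa using translate_const (δ := δ) b 1
  map_zero' := by simpa using translate_const (δ := δ) b 0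
  map_add' := translate_add b
  map_mul' := translate_mul b

theorem translateHom_apply (b : K) (p : DiffPoly δ) : translateHom b p = translate b p := rfl

theorem translate_translate (a b : K) (p : DiffPoly δ) :
    translate a (translate b p) = translate (a + b) p := by
  induction p using induction_on with
  | add p q hp hq => rw [translate_add, translate_add, translate_add, hp, hq]
  | monomial n e =>
    rw [translate_monomial, translate_const_mul, translate_monomial]
    congr 1
    rw [← translateHom_apply, map_pow, translateHom_apply, translate_add, translate_t,
      translate_const, map_add, add_assoc]

theorem translate_zero (p : DiffPoly δ) : translate 0 p = p := by
  conv_rhs => rw [eq_sum p]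
  simp [translate]

theorem degree_translate_le (b : K) (p : DiffPoly δ) :
    (toPoly δ (translate b p)).degree ≤ (toPoly δ p).degree := by
  have h : ∀ n : ℕ, (toPoly δ ((t δ + const δ b) ^ n)).degree = n := by
    intro n
    induction n with
    | zero => exact degree_one
    | succ n ih =>
      rw [pow_succ, degree_toPoly_mul, ih, map_add, toPoly_t, toPoly_const, degree_X_add_C]
      rfl
  rw [translate, Polynomial.sum, map_sum]
  refine (degree_sum_le _ _).trans (Finset.sup_le fun i hi => ?_)
  rw [degree_toPoly_mul, h, toPoly_const]
  refine le_trans ?_ (le_degree_of_mem_supp i hi)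
  rw [degree_C (mem_support_iff.mp hi), zero_add]

/-! ### The polynomial `t ^ 3 - c t - d` in characteristic three -/

theorem three_eq_zero [CharP K 3] : (3 : DiffPoly δ) = 0 := by
  have : ((3 : ℕ) : K) = 0 := CharP.cast_eq_zero K 3
  rw [← map_zero (const δ), ← this, map_natCast]; rfl

theorem t_add_const_pow_three [CharP K 3] (b : K) :
    (t δ + const δ b) ^ 3 = t δ ^ 3 + const δ (b ^ 3 + δ (δ b)) := by
  rw [add_pow_three_of_three_eq_zero three_eq_zero (t_mul_const b) (t_mul_const (δ b))
    (by rw [← map_mul, ← map_mul, mul_comm]), map_add, map_pow, add_assoc]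

theorem t_pow_three_mul_const [CharP K 3] (a : K) :
    t δ ^ 3 * const δ a = const δ a * t δ ^ 3 + const δ (δ (δ (δ a))) :=
  pow_three_mul_of_three_eq_zero three_eq_zero (t_mul_const a) (t_mul_const (δ a))
    (t_mul_const _)

theorem derivation_pow_three [CharP K 3] (a : K) : δ (a ^ 3) = 0 := by
  have : (3 : K) = 0 := by exact_mod_cast CharP.cast_eq_zero K 3
  rw [Derivation.leibniz_pow]
  simp [this]

variable (δ) in
/-- The differential polynomial `t ^ 3 - c t - d`. -/
noncomputable def cubic (c d : K) : DiffPoly δ := t δ ^ 3 - const δ c * t δ - const δ d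

theorem toPoly_cubic (c d : K) : toPoly δ (cubic δ c d) = X ^ 3 - C c * X - C d := by
  rw [cubic, map_sub, map_sub, toPoly_t_pow, const_mul, map_smul, toPoly_t, smul_eq_C_mul]
  rfl

theorem natDegree_cubic (c d : K) : (toPoly δ (cubic δ c d)).natDegree = 3 := by
  rw [toPoly_cubic]; compute_degree!

theorem cubic_ne_zero (c d : K) : cubic δ c d ≠ 0 := by
  intro h
  have := natDegree_cubic (δ := δ) c d
  rw [h, map_zero, natDegree_zero] at this
  omega

theorem mem_lowDegree_cubic {c d : K} {p : DiffPoly δ} :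
    p ∈ lowDegree (cubic δ c d) ↔ (toPoly δ p).degree < 3 := by
  show toPoly δ p ∈ degreeLT K _ ↔ _
  rw [natDegree_cubic, mem_degreeLT]; rfl

theorem cubic_mul_const [CharP K 3] {c : K} (hδ : ∀ y, δ (δ (δ y)) = c * δ y) (d a : K) :
    cubic δ c d * const δ a = const δ a * cubic δ c d := by
  rw [cubic, sub_mul, sub_mul, t_pow_three_mul_const, mul_assoc, t_mul_const, hδ, mul_sub, mul_sub,
    mul_add, ← mul_assoc, ← mul_assoc, ← map_mul, ← map_mul, ← map_mul, ← map_mul, mul_comm c a,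
    mul_comm d a, map_mul _ a d]
  abel

/-- The coefficient `c` is constant, so `d` alone obstructs commutation with `t`. -/
theorem cubic_mul_t {c : K} (hc : δ c = 0) (d : K) :
    cubic δ c d * t δ = t δ * cubic δ c d + const δ (δ d) := by
  rw [cubic, sub_mul, sub_mul, mul_sub, mul_sub, t_mul_const_mul, hc, map_zero, zero_mul, add_zero,
    t_mul_const, ← pow_succ, ← pow_succ', mul_assoc]
  abel

theorem translate_cubic [CharP K 3] {b c : K} (hb : b ^ 3 + δ (δ b) - c * b = 0) (d : K) :
    translate b (cubic δ c d) = cubic δ c d := by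
  rw [cubic, ← translateHom_apply, map_sub, map_sub, map_pow, map_mul]
  simp only [translateHom_apply, translate_t, translate_const]
  rw [t_add_const_pow_three, mul_add, ← map_mul, sub_eq_zero.mp hb]
  abel

/-- Cubes are constants, and `δ(δ² a) = c δ a = δ(c a)`. -/
theorem derivation_norm [CharP K 3] {c : K} (hc : δ c = 0) (hδ : ∀ y, δ (δ (δ y)) = c * δ y)
    (a : K) : δ (a ^ 3 + δ (δ a) - c * a) = 0 := by
  rw [map_sub, map_add, derivation_pow_three, hδ, Derivation.leibniz, hc]
  simp

/-- Division by a linear polynomial on the right; the identity holds in general up to `3 a δ(a)`. -/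
theorem cubic_eq_mul_sub_add [CharP K 3] (a c d : K) :
    cubic δ c d = (t δ ^ 2 + const δ a * t δ + const δ (a ^ 2 + δ a + δ a - c)) *
      (t δ - const δ a) + const δ (a ^ 3 + δ (δ a) - c * a - d) := by
  have h0 := t_mul_const (δ := δ) a
  have h1 := t_mul_const (δ := δ) (δ a)
  have h2 : const δ (δ a) * const δ a = const δ a * const δ (δ a) := by
    rw [← map_mul, ← map_mul, mul_comm]
  have h : cubic δ c d = (t δ ^ 2 + const δ a * t δ + const δ (a ^ 2 + δ a + δ a - c)) *
      (t δ - const δ a) + const δ (a ^ 3 + δ (δ a) - c * a - d) +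
      3 * (const δ a * const δ (δ a)) := by
    rw [show (3 : DiffPoly δ) = 1 + 1 + 1 by norm_num]
    simp only [cubic, map_add, map_sub, map_mul, pow_succ, pow_zero, one_mul, add_mul, sub_mul,
      mul_add, mul_sub, mul_assoc, h0, h1, h2, mul_mul_of_mul_eq h0]
    abel
  rw [h, three_eq_zero, zero_mul, add_zero]

theorem cubic_eq_sub_mul_add [CharP K 3] {c : K} (hc : δ c = 0) (a d : K) :
    cubic δ c d = (t δ - const δ a) * (t δ ^ 2 + const δ a * t δ + const δ (a ^ 2 - δ a - c))
      + const δ (a ^ 3 + δ (δ a) - c * a - d) := by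
  have h0 := t_mul_const (δ := δ) a
  have h1 := t_mul_const (δ := δ) (δ a)
  have hc' := t_mul_const (δ := δ) c
  rw [hc, map_zero, add_zero] at hc'
  have h2 : const δ (δ a) * const δ a = const δ a * const δ (δ a) := by
    rw [← map_mul, ← map_mul, mul_comm]
  have h4 : const δ c * const δ a = const δ a * const δ c := by
    rw [← map_mul, ← map_mul, mul_comm]
  have h : cubic δ c d =
      (t δ - const δ a) * (t δ ^ 2 + const δ a * t δ + const δ (a ^ 2 - δ a - c))
      + const δ (a ^ 3 + δ (δ a) - c * a - d) - 3 * (const δ a * const δ (δ a)) := by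
    rw [show (3 : DiffPoly δ) = 1 + 1 + 1 by norm_num]
    simp only [cubic, map_add, map_sub, map_mul, pow_succ, pow_zero, one_mul, add_mul,
      sub_mul, mul_add, mul_sub, mul_assoc, h0, h1, h2, hc', h4, mul_mul_of_mul_eq h0]
    abel
  rw [h, three_eq_zero, zero_mul, sub_zero]

/-- A nonzero constant has degree zero, so it has no linear factor. -/
theorem eq_of_const_eq_mul {a b : K} {p q : DiffPoly δ}
    (hq : (toPoly δ q).natDegree = 1) (h : const δ (a - b) = p * q ∨ const δ (a - b) = q * p) :
    b = a := by
  by_contra hab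
  have h0 : const δ (a - b) ≠ 0 := by
    rw [Ne, ← map_zero (const δ), const_injective.eq_iff]
    exact sub_ne_zero.mpr (Ne.symm hab)
  have h1 : (toPoly δ (const δ (a - b))).natDegree = 0 := natDegree_C _
  rcases h with h | h
  · rw [h] at h0 h1
    rw [natDegree_toPoly_mul (left_ne_zero_of_mul h0) (right_ne_zero_of_mul h0)] at h1
    omega
  · rw [h] at h0 h1
    rw [natDegree_toPoly_mul (left_ne_zero_of_mul h0) (right_ne_zero_of_mul h0)] at h1
    omega

/-! ### Irreducibility of `t³ - c t - d` -/

section Irreducible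

variable [CharP K 3] {c d : K}

theorem cubic_ne_mul_of_natDegree_right_eq_one (hc : δ c = 0)
    (hδ : ∀ y, δ (δ (δ y)) = c * δ y) (hd : δ d ≠ 0) {p q : DiffPoly δ}
    (hq : (toPoly δ q).natDegree = 1) : cubic δ c d ≠ p * q := by
  intro h
  obtain ⟨u, a, rfl⟩ := eq_mul_sub_of_natDegree_eq_one hq
  have h1 := cubic_eq_mul_sub_add (δ := δ) a c d
  rw [h, ← mul_assoc, ← sub_eq_iff_eq_add', ← sub_mul] at h1
  refine hd ?_
  rw [eq_of_const_eq_mul (natDegree_t_sub_const a) (Or.inl h1.symm)]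
  exact derivation_norm hc hδ a

theorem cubic_ne_mul_of_natDegree_left_eq_one (hc : δ c = 0)
    (hδ : ∀ y, δ (δ (δ y)) = c * δ y) (hd : δ d ≠ 0) {p q : DiffPoly δ}
    (hp : (toPoly δ p).natDegree = 1) : cubic δ c d ≠ p * q := by
  intro h
  obtain ⟨u, a, rfl⟩ := eq_sub_mul_of_natDegree_eq_one hp
  have h1 := cubic_eq_sub_mul_add (δ := δ) hc a d
  rw [h, mul_assoc, ← sub_eq_iff_eq_add', ← mul_sub] at h1
  refine hd ?_
  rw [eq_of_const_eq_mul (natDegree_t_sub_const a) (Or.inr h1.symm)]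
  exact derivation_norm hc hδ a

/-- The product of two nonzero differential polynomials of degree less than three is no left
multiple of the irreducible polynomial `t ^ 3 - c t - d`. -/
theorem mul_ne_mul_cubic (hc : δ c = 0) (hδ : ∀ y, δ (δ (δ y)) = c * δ y) (hd : δ d ≠ 0)
    {g h q : DiffPoly δ} (hg : g ≠ 0) (hh : h ≠ 0)
    (hg3 : (toPoly δ g).natDegree < 3) (hh3 : (toPoly δ h).natDegree < 3) :
    g * h ≠ q * cubic δ c d := by
  intro e
  have hq : q ≠ 0 := by
    rintro rfl
    rw [zero_mul] at e
    exact mul_ne_zero hg hh e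
  have hdeg := natDegree_toPoly_mul hg hh
  rw [e, natDegree_toPoly_mul hq (cubic_ne_zero c d), natDegree_cubic] at hdeg
  have hinv : ∀ {k : K} {p : DiffPoly δ}, const δ k ≠ 0 →
      const δ k⁻¹ * (const δ k * p) = p := by
    intro k p hk
    have hk' : k ≠ 0 := by rintro rfl; exact hk (map_zero _)
    rw [← mul_assoc, ← map_mul, inv_mul_cancel₀ hk', map_one, one_mul]
  -- Degrees force `deg q ≤ 1`. If `q` is a constant, `f` is a unit times `g h`, and one of the
  -- factors is linear.
  by_cases hq0 : (toPoly δ q).natDegree = 0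
  · obtain ⟨k, rfl⟩ := eq_const_of_natDegree_eq_zero hq0
    have hf : cubic δ c d = (const δ k⁻¹ * g) * h := by rw [mul_assoc, e, hinv hq]
    by_cases h1 : (toPoly δ h).natDegree = 1
    · exact cubic_ne_mul_of_natDegree_right_eq_one hc hδ hd h1 hf
    · have h0 : const δ k⁻¹ ≠ 0 := by
        intro h0
        rw [h0, zero_mul, zero_mul] at hf
        exact cubic_ne_zero c d hf
      refine cubic_ne_mul_of_natDegree_left_eq_one hc hδ hd ?_ hf
      rw [natDegree_toPoly_mul h0 hg, toPoly_const, natDegree_C]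
      omega
  -- If `q` is linear, `g` and `h` are quadratic. Dividing `f` by `h` either gives a linear left
  -- factor or a nonzero remainder `r`.
  · have hh2 : (toPoly δ h).natDegree = 2 := by omega
    obtain ⟨u, r, hur, hr⟩ : ∃ u r : DiffPoly δ, cubic δ c d = u * h + r ∧
        (toPoly δ r).degree < (toPoly δ h).natDegree :=
      exists_division (δ := δ) (toPoly_ne_zero hh) (toPoly δ (cubic δ c d))
    by_cases hr0 : r = 0
    · rw [hr0, add_zero] at hur
      have hu : u ≠ 0 := by
        rintro rfl
        rw [zero_mul] at hur
        exact cubic_ne_zero c d hur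
      have h3 := natDegree_toPoly_mul hu hh
      rw [← hur, natDegree_cubic] at h3
      exact cubic_ne_mul_of_natDegree_left_eq_one hc hδ hd (by omega) hur
    have e2 : q * r = (g - q * u) * h := by
      rw [sub_mul, e, hur, mul_add, mul_assoc]; abel
    have hqr := mul_ne_zero hq hr0
    have hk0 : g - q * u ≠ 0 := by
      intro h0
      rw [h0, zero_mul] at e2
      exact hqr e2
    have h4 := natDegree_toPoly_mul hq hr0
    rw [e2, natDegree_toPoly_mul hk0 hh] at h4
    rw [← natDegree_lt_iff_degree_lt (toPoly_ne_zero hr0)] at hr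
    -- As `deg (q r) ≤ 2 = deg h`, the cofactor of `h` is a constant and `r` is linear. Then `h` is
    -- a left multiple of `r`, hence so is `f = u h + r`.
    obtain ⟨k, hk⟩ := eq_const_of_natDegree_eq_zero (p := g - q * u) (by omega)
    rw [hk] at e2 hk0
    have h5 : h = const δ k⁻¹ * (q * r) := by rw [e2, hinv hk0]
    refine cubic_ne_mul_of_natDegree_right_eq_one hc hδ hd
      (p := u * const δ k⁻¹ * q + 1) (q := r) (by omega) ?_
    rw [add_mul, one_mul, mul_assoc, mul_assoc, ← h5, ← hur]

end Irreducible

end DiffPoly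

/-! ### The degree of `K` over its constants -/

section Derivation

variable {K : Type*} [Field K] {δ : Derivation ℤ K K}

theorem derivation_div {z : K} (hz : z ≠ 0) (y : K) :
    δ (y / z) = (δ y * z - y * δ z) / z ^ 2 := by
  rw [Derivation.leibniz_div]
  simp only [smul_eq_mul]
  field_simp

/-- The Wronskian of `δ x` and `δ y` is a constant. -/
theorem derivation_wronskian_eq_zero {c : K} (hδ : ∀ y, δ (δ (δ y)) = c * δ y) (x y : K) :
    δ (δ (δ y) * δ x - δ y * δ (δ x)) = 0 := by
  rw [map_sub, Derivation.leibniz, Derivation.leibniz, hδ, hδ]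
  simp only [smul_eq_mul]
  ring

/-- By the quotient rule `u = δ y / δ x` is a constant, and then so is `y - u x`. -/
theorem mem_span_of_wronskian_eq_zero {x : K} (hx : δ x ≠ 0) {y : K}
    (h : δ (δ y) * δ x - δ y * δ (δ x) = 0) :
    y ∈ Submodule.span (constField δ) {1, x} := by
  have hu : δ (δ y / δ x) = 0 := by rw [derivation_div hx, h, zero_div]
  have hv : δ (y - δ y / δ x * x) = 0 := by
    rw [map_sub, Derivation.leibniz, hu]
    simp only [smul_eq_mul]
    field_simp
    ring
  rw [Submodule.mem_span_pair]
  refine ⟨⟨_, hv⟩, ⟨_, hu⟩, ?_⟩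
  show (y - δ y / δ x * x) * 1 + δ y / δ x * x = y
  ring

/-- The Wronskian with `x` is `F`-linear in `y` with values in `F`. Subtracting a multiple of one
`y₀` with nonzero Wronskian therefore moves every `y` into its kernel, which lies in the span of `1`
and `x`. -/
theorem exists_span_triple_eq_top {c : K} (hδ : ∀ y, δ (δ (δ y)) = c * δ y) {x : K}
    (hx : δ x ≠ 0) : ∃ y, Submodule.span (constField δ) {y, 1, x} = ⊤ := by
  set W : K → K := fun y => δ (δ y) * δ x - δ y * δ (δ x) with hW
  -- If all Wronskians vanish, any `y₀` will do, and `0` is taken.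
  obtain ⟨y₀, h₀⟩ : ∃ y₀, W y₀ = 0 → ∀ y, W y = 0 := by
    by_cases h : ∃ y, W y ≠ 0
    · exact h.imp fun y hy h => absurd h hy
    · push Not at h
      exact ⟨0, fun _ => h⟩
  refine ⟨y₀, eq_top_iff.mpr fun y _ => ?_⟩
  have hle : Submodule.span (constField δ) {1, x} ≤ Submodule.span (constField δ) {y₀, 1, x} :=
    Submodule.span_mono (Set.subset_insert _ _)
  by_cases h1 : W y₀ = 0
  · exact hle (mem_span_of_wronskian_eq_zero hx (h₀ h1 y))
  have hW0 : ∀ y, δ (W y) = 0 := derivation_wronskian_eq_zero hδ x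
  have hs : δ (W y / W y₀) = 0 := by
    rw [derivation_div h1, hW0, hW0]; simp
  have h2 : y - W y / W y₀ * y₀ ∈ Submodule.span (constField δ) {1, x} := by
    refine mem_span_of_wronskian_eq_zero hx ?_
    have e1 : δ (y - W y / W y₀ * y₀) = δ y - W y / W y₀ * δ y₀ := by
      rw [map_sub, Derivation.leibniz, hs]; simp
    have e2 : δ (δ y - W y / W y₀ * δ y₀) = δ (δ y) - W y / W y₀ * δ (δ y₀) := by
      rw [map_sub, Derivation.leibniz, hs]; simp
    rw [e1, e2]
    have e3 : W y / W y₀ * W y₀ = W y := div_mul_cancel₀ _ h1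
    linear_combination -e3
  have h3 := Submodule.smul_mem (Submodule.span (constField δ) {y₀, 1, x})
    (⟨W y / W y₀, hs⟩ : constField δ) (Submodule.subset_span (Set.mem_insert y₀ _))
  have h4 := add_mem (hle h2) h3
  have h5 : y - W y / W y₀ * y₀ + W y / W y₀ * y₀ = y := sub_add_cancel _ _
  exact h5 ▸ h4

/-- The lower bound holds because the cubic minimal polynomial divides the characteristic
polynomial, whose degree is the dimension. -/
theorem finrank_constField {c : constField δ}
    (hmin : minpoly (constField δ) (derivationEnd δ) = X ^ 3 - C c * X)
    (hδ : ∀ y, δ (δ (δ y)) = c * δ y) {x : K} (hx : δ x ≠ 0) :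
    Module.finrank (constField δ) K = 3 := by
  obtain ⟨y, hy⟩ := exists_span_triple_eq_top hδ hx
  have hfin : Module.Finite (constField δ) K :=
    ⟨hy ▸ Submodule.fg_span (Set.toFinite _)⟩
  refine le_antisymm ?_ ?_
  · classical
    have h := finrank_span_finset_le_card (R := constField δ) (M := K) {y, 1, x}
    have hy' : Submodule.span (constField δ) (({y, 1, x} : Finset K) : Set K) = ⊤ := by
      simpa using hy
    rw [Set.finrank, hy', finrank_top] at h
    exact h.trans Finset.card_le_three
  · have h := natDegree_le_of_dvd (LinearMap.minpoly_dvd_charpoly (derivationEnd δ))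
      (LinearMap.charpoly_monic _).ne_zero
    rw [hmin, LinearMap.charpoly_natDegree] at h
    refine le_trans (le_of_eq ?_) h
    symm; compute_degree!

theorem derivation_cube_eq {c : constField δ}
    (hmin : minpoly (constField δ) (derivationEnd δ) = X ^ 3 - C c * X) (y : K) :
    δ (δ (δ y)) = c * δ y := by
  have h := minpoly.aeval (constField δ) (derivationEnd δ)
  rw [hmin] at h
  have h2 := LinearMap.congr_fun h y
  simp only [map_sub, map_mul, map_pow, aeval_X, aeval_C, LinearMap.sub_apply] at h2
  exact sub_eq_zero.mp h2

/-! ### Logarithmic derivatives as the zeros of `V` -/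

theorem cubicNorm_neg {c a : K} (ha : a ^ 3 + δ (δ a) - c * a = 0) :
    (-a) ^ 3 + δ (δ (-a)) - c * (-a) = 0 := by
  rw [map_neg, map_neg]
  linear_combination -ha

variable [CharP K 3]

theorem three_eq_zero_of_charP : (3 : K) = 0 := by
  exact_mod_cast CharP.cast_eq_zero K 3

/-- If `δ b = r b`, then `δ³ b = (r³ + 3 r δ r + δ² r) b`, so `δ³ b = c δ b` becomes `V(r) b = 0`.
-/
theorem cubicNorm_logDerivative {c : K} (hδ : ∀ y, δ (δ (δ y)) = c * δ y) {b : K} (hb : b ≠ 0) :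
    (δ b / b) ^ 3 + δ (δ (δ b / b)) - c * (δ b / b) = 0 := by
  obtain ⟨r, hr⟩ : ∃ r, r = δ b / b := ⟨_, rfl⟩
  rw [← hr]
  have h1 : δ b = r * b := by rw [hr, div_mul_cancel₀ _ hb]
  have h2 : δ (δ b) = δ r * b + r * (r * b) := by
    rw [h1, Derivation.leibniz, h1]; simp only [smul_eq_mul]; ring
  have h3 := hδ b
  rw [h2, map_add, Derivation.leibniz, Derivation.leibniz, Derivation.leibniz, h1] at h3
  simp only [smul_eq_mul] at h3
  refine mul_right_cancel₀ hb ?_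
  linear_combination h3 - r * δ r * b * three_eq_zero_of_charP (K := K)

theorem exists_logDerivative_eq {c : K} (hc : δ c = 0) (hδ : ∀ y, δ (δ (δ y)) = c * δ y) {x : K}
    (hx : δ x ≠ 0) {a : K} (ha : a ^ 3 + δ (δ a) - c * a = 0) :
    ∃ b : K, b ≠ 0 ∧ a = δ b / b := by
  -- This is the quotient from `cubic_eq_sub_mul_add` as an operator: `δ³ - c δ = (δ - a) w + V(a)`.
  -- Hence every value of `w` solves `δ z = a z`.
  set w : K → K := fun y => δ (δ y) + a * δ y + (a ^ 2 - δ a - c) * y with hw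
  have hδw : ∀ y, δ (w y) = a * w y := by
    intro y
    simp only [hw, map_add, map_sub, Derivation.leibniz, Derivation.leibniz_pow, hδ, hc,
      smul_eq_mul, nsmul_eq_mul]
    push_cast
    linear_combination -y * ha + (y * a * δ a) * three_eq_zero_of_charP (K := K)
  by_cases h : ∃ y, w y ≠ 0
  · obtain ⟨y, hy⟩ := h
    exact ⟨w y, hy, by rw [hδw, mul_div_cancel_right₀ _ hy]⟩
  push Not at h
  exfalso
  -- If `w` were zero, its value at `1` would kill the last coefficient; comparing the values at `x`
  -- and `x²` then leaves `2 (δ x)² = 0`.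
  have h1 : a ^ 2 - δ a - c = 0 := by simpa [hw] using h 1
  have h2 := h x
  have h3 := h (x * x)
  simp only [hw, h1, Derivation.leibniz, smul_eq_mul, map_add] at h2 h3
  have h4 : δ x * δ x = 0 := by
    linear_combination 2 * x * h2 - h3 + δ x * δ x * three_eq_zero_of_charP (K := K)
  exact hx (mul_self_eq_zero.mp h4)

end Derivation

/-! ### Remainders and associators in `S_f` -/

namespace PetitAlgebra

open DiffPoly

variable {K : Type*} [Field K] {δ : Derivation ℤ K K}

theorem toDiffPoly_injective (f : DiffPoly δ) : Function.Injective (toDiffPoly f) :=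
  Subtype.val_injective

theorem toDiffPoly_mk_of_mem {f p : DiffPoly δ} (h : p ∈ lowDegree f) :
    toDiffPoly f (mk f p) = p :=
  congrArg Subtype.val (modR_coe (⟨p, h⟩ : lowDegree f))

theorem toDiffPoly_mem (f : DiffPoly δ) (x : PetitAlgebra f) : toDiffPoly f x ∈ lowDegree f := x.2

theorem mk_spec {f : DiffPoly δ} (hf : f ≠ 0) (p : DiffPoly δ) :
    ∃ q, p = q * f + toDiffPoly f (mk f p) := modR_spec hf p

theorem mk_mul_self {f : DiffPoly δ} (hf : f ≠ 0) (q : DiffPoly δ) : mk f (q * f) = 0 :=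
  modR_eq hf (q := q) (r := 0) (by rw [Submodule.coe_zero, add_zero])

/-- The multiples `q f` form a left ideal, so a right factor may be reduced modulo `f`. -/
theorem mk_mul_mk {f : DiffPoly δ} (hf : f ≠ 0) (p q : DiffPoly δ) :
    mk f (p * toDiffPoly f (mk f q)) = mk f (p * q) := by
  obtain ⟨r, hr⟩ := mk_spec hf q
  conv_rhs => rw [hr, mul_add, ← mul_assoc, map_add, mk_mul_self hf, zero_add]

/-- Only the reduction of `x y` inside `(x ∘ y) ∘ z` matters, since the inner reduction in `x ∘ (y ∘
z)` is harmless. -/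
theorem associator_eq {f : DiffPoly δ} (hf : f ≠ 0) {x y z : PetitAlgebra f} {q : DiffPoly δ}
    (h : toDiffPoly f x * toDiffPoly f y = q * f + toDiffPoly f (x * y)) :
    associator x y z = -mk f (q * f * toDiffPoly f z) := by
  rw [associator, mul_def f (x * y) z, mul_def f x (y * z), mul_def f y z, mk_mul_mk hf, ← mul_assoc,
    h, add_mul, map_add]
  abel

theorem finrank_eq_natDegree (f : DiffPoly δ) :
    Module.finrank K (PetitAlgebra f) = (toPoly δ f).natDegree := by
  have e : PetitAlgebra f ≃ₗ[K] (Fin (toPoly δ f).natDegree → K) :=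
    ((toPoly δ).ofSubmodule' _).trans (degreeLTEquiv K _)
  rw [e.finrank_eq, Module.finrank_fin_fun]

theorem IsTranslation.unique {f : DiffPoly δ} {b : K} {σ τ : RingAut (PetitAlgebra f)}
    (hσ : IsTranslation f b σ) (hτ : IsTranslation f b τ) : σ = τ :=
  RingEquiv.ext fun x => toDiffPoly_injective f ((hσ x).trans (hτ x).symm)

theorem IsTranslation.mul {f : DiffPoly δ} {a b : K} {σ τ : RingAut (PetitAlgebra f)}
    (hσ : IsTranslation f a σ) (hτ : IsTranslation f b τ) : IsTranslation f (a + b) (σ * τ) :=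
  fun x => by rw [RingAut.mul_apply, hσ, hτ, DiffPoly.translate_translate]

/-! ### The nuclei for `t³ - c t - d` -/

section Cubic

variable {c d : K}

theorem toDiffPoly_degree_lt (x : PetitAlgebra (cubic δ c d)) :
    (toPoly δ (toDiffPoly _ x)).degree < 3 := mem_lowDegree_cubic.mp (toDiffPoly_mem _ x)

theorem toDiffPoly_natDegree_lt (x : PetitAlgebra (cubic δ c d)) :
    (toPoly δ (toDiffPoly _ x)).natDegree < 3 := by
  by_cases h : toPoly δ (toDiffPoly _ x) = 0
  · rw [h, natDegree_zero]; norm_num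
  · exact (natDegree_lt_iff_degree_lt h).mpr (toDiffPoly_degree_lt x)

theorem t_mem_lowDegree : t δ ∈ lowDegree (cubic δ c d) := by
  rw [mem_lowDegree_cubic, toPoly_t, degree_X]; norm_num

theorem t_sq_mem_lowDegree : t δ ^ 2 ∈ lowDegree (cubic δ c d) := by
  rw [mem_lowDegree_cubic, toPoly_t_pow, degree_X_pow]; norm_num

theorem quotient_degree_lt {x y : PetitAlgebra (cubic δ c d)} {q : DiffPoly δ}
    (h : toDiffPoly _ x * toDiffPoly _ y = q * cubic δ c d + toDiffPoly _ (x * y)) (hq : q ≠ 0) :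
    (toPoly δ q).natDegree < 2 := by
  have h1 := toDiffPoly_degree_lt (x * y)
  have h2 : q * cubic δ c d = toDiffPoly _ x * toDiffPoly _ y - toDiffPoly _ (x * y) := by
    rw [h, add_sub_cancel_right]
  have h3 := natDegree_toPoly_mul hq (cubic_ne_zero (δ := δ) c d)
  have h4 : (toPoly δ (toDiffPoly _ x * toDiffPoly _ y)).natDegree ≤ 4 := by
    by_cases hx : toDiffPoly _ x = 0
    · rw [hx, zero_mul, map_zero, natDegree_zero]; omega
    by_cases hy : toDiffPoly _ y = 0
    · rw [hy, mul_zero, map_zero, natDegree_zero]; omega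
    rw [natDegree_toPoly_mul hx hy]
    have := toDiffPoly_natDegree_lt x
    have := toDiffPoly_natDegree_lt y
    omega
  rw [h2, map_sub, DiffPoly.natDegree_cubic] at h3
  have h5 := natDegree_sub_le (toPoly δ (toDiffPoly _ x * toDiffPoly _ y))
    (toPoly δ (toDiffPoly _ (x * y)))
  have h6 := toDiffPoly_natDegree_lt (x * y)
  have h7 := le_trans h5 (max_le h4 (by omega))
  omega

/-- Associating with `t` tests whether `x y` needs reduction: `q f t` is congruent to `q δ(d)`,
whose degree is at most one, so it is a multiple of `f` only for `q = 0`. -/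
theorem toDiffPoly_mul_of_associator_eq_zero (hc : δ c = 0) (hd : δ d ≠ 0)
    {x y : PetitAlgebra (cubic δ c d)} (h : associator x y (mk _ (t δ)) = 0) :
    toDiffPoly _ x * toDiffPoly _ y = toDiffPoly _ (x * y) := by
  have hf := cubic_ne_zero (δ := δ) c d
  obtain ⟨q, hq⟩ := mk_spec hf (toDiffPoly _ x * toDiffPoly _ y)
  rw [← mul_def] at hq
  rw [associator_eq hf hq, toDiffPoly_mk_of_mem t_mem_lowDegree, mul_assoc, cubic_mul_t hc, mul_add,
    ← mul_assoc, map_add, mk_mul_self hf, zero_add, neg_eq_zero] at h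
  have hq0 : q = 0 := by
    by_contra hq0
    have hlt := quotient_degree_lt hq hq0
    have hd0 : const δ (δ d) ≠ 0 := by
      rw [Ne, ← map_zero (const δ), const_injective.eq_iff]; exact hd
    obtain ⟨r, hr⟩ := mk_spec hf (q * const δ (δ d))
    rw [h, map_zero, add_zero] at hr
    have hr0 : r ≠ 0 := by
      rintro rfl
      rw [zero_mul] at hr
      exact mul_ne_zero hq0 hd0 hr
    have h1 := natDegree_toPoly_mul hq0 hd0
    rw [hr, natDegree_toPoly_mul hr0 hf, DiffPoly.natDegree_cubic, toPoly_const, natDegree_C] at h1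
    omega
  rw [hq, hq0, zero_mul, zero_add]

theorem mem_constants_of_natDegree_eq_zero {f : DiffPoly δ} {x : PetitAlgebra f}
    (h : (toPoly δ (toDiffPoly f x)).natDegree = 0) : x ∈ constants f :=
  eq_const_of_natDegree_eq_zero h

theorem toDiffPoly_mul_of_mem_constants {x y : PetitAlgebra (cubic δ c d)}
    (h : x ∈ constants _ ∨ y ∈ constants _) :
    toDiffPoly _ x * toDiffPoly _ y = toDiffPoly _ (x * y) := by
  rw [mul_def, toDiffPoly_mk_of_mem]
  rw [mem_lowDegree_cubic, degree_toPoly_mul]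
  rcases h with ⟨a, ha⟩ | ⟨a, ha⟩
  · rw [ha, toPoly_const]
    exact (add_le_add_left degree_C_le _).trans_lt
      ((zero_add _).trans_lt (toDiffPoly_degree_lt y))
  · rw [ha, toPoly_const]
    exact (add_le_add_right degree_C_le _).trans_lt
      ((add_zero _).trans_lt (toDiffPoly_degree_lt x))

theorem associator_eq_zero_of_mem_constants {x y : PetitAlgebra (cubic δ c d)}
    (h : x ∈ constants _ ∨ y ∈ constants _) (z : PetitAlgebra (cubic δ c d)) :
    associator x y z = 0 := by
  rw [associator_eq (cubic_ne_zero c d) (q := 0) (by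
    rw [zero_mul, zero_add, toDiffPoly_mul_of_mem_constants h])]
  simp

theorem natDegree_eq_zero_of_mul_t_sq {p : DiffPoly δ}
    (h : (toPoly δ (p * t δ ^ 2)).natDegree < 3 ∨ (toPoly δ (t δ ^ 2 * p)).natDegree < 3) :
    (toPoly δ p).natDegree = 0 := by
  by_cases hp : p = 0
  · rw [hp, map_zero, natDegree_zero]
  have ht : t δ ^ 2 ≠ 0 := pow_ne_zero _ (X_ne_zero : (X : K[X]) ≠ 0)
  rw [natDegree_toPoly_mul hp ht, natDegree_toPoly_mul ht hp, toPoly_t_pow, natDegree_X_pow] at h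
  omega

/-- Testing on `t²` and `t` shows that `x t²` needs no reduction, so `x` has degree zero. -/
theorem leftNucleus_eq (hc : δ c = 0) (hd : δ d ≠ 0) :
    leftNucleus (PetitAlgebra (cubic δ c d)) = constants _ := by
  refine Set.Subset.antisymm (fun x hx => ?_)
    fun x hx y z => associator_eq_zero_of_mem_constants (Or.inl hx) z
  refine mem_constants_of_natDegree_eq_zero (natDegree_eq_zero_of_mul_t_sq (Or.inl ?_))
  have h := toDiffPoly_mul_of_associator_eq_zero hc hd (hx (mk _ (t δ ^ 2)) _)
  rw [toDiffPoly_mk_of_mem t_sq_mem_lowDegree] at h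
  rw [h]
  exact toDiffPoly_natDegree_lt _

theorem middleNucleus_eq (hc : δ c = 0) (hd : δ d ≠ 0) :
    middleNucleus (PetitAlgebra (cubic δ c d)) = constants _ := by
  refine Set.Subset.antisymm (fun x hx => ?_)
    fun x hx y z => associator_eq_zero_of_mem_constants (Or.inr hx) z
  refine mem_constants_of_natDegree_eq_zero (natDegree_eq_zero_of_mul_t_sq (Or.inr ?_))
  have h := toDiffPoly_mul_of_associator_eq_zero hc hd (hx (mk _ (t δ ^ 2)) _)
  rw [toDiffPoly_mk_of_mem t_sq_mem_lowDegree] at h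
  rw [h]
  exact toDiffPoly_natDegree_lt _

theorem not_associative (hc : δ c = 0) (hd : δ d ≠ 0) :
    ¬ ∀ x y z : PetitAlgebra (cubic δ c d), x * y * z = x * (y * z) := by
  intro h
  have h1 : mk (cubic δ c d) (t δ) ∈ leftNucleus _ := fun y z => sub_eq_zero.mpr (h _ y z)
  rw [leftNucleus_eq hc hd] at h1
  obtain ⟨a, ha⟩ := h1
  rw [toDiffPoly_mk_of_mem t_mem_lowDegree] at ha
  exact t_sub_const_ne_zero a (sub_eq_zero.mpr ha)

/-- The map induced by `G_{id, b}` on the space of remainders. -/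
noncomputable def translateRemainder (b : K) (x : PetitAlgebra (cubic δ c d)) :
    PetitAlgebra (cubic δ c d) :=
  ⟨DiffPoly.translate b (toDiffPoly _ x), mem_lowDegree_cubic.mpr
    ((degree_translate_le _ _).trans_lt (toDiffPoly_degree_lt x))⟩

theorem toDiffPoly_translateRemainder (b : K) (x : PetitAlgebra (cubic δ c d)) :
    toDiffPoly _ (translateRemainder b x) = translate b (toDiffPoly _ x) := rfl

theorem IsTranslation.parameter_unique {a b : K} {σ : RingAut (PetitAlgebra (cubic δ c d))}
    (ha : IsTranslation _ a σ) (hb : IsTranslation _ b σ) : a = b := by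
  have h := (ha (mk _ (t δ))).symm.trans (hb (mk _ (t δ)))
  rw [toDiffPoly_mk_of_mem t_mem_lowDegree, translate_t, translate_t] at h
  exact const_injective (add_left_cancel h)

/-! ### Right nucleus, division property and automorphisms -/

variable [CharP K 3]

theorem constants_subset_rightNucleus (hδ : ∀ y, δ (δ (δ y)) = c * δ y) :
    constants (cubic δ c d) ⊆ rightNucleus _ := by
  rintro x ⟨a, ha⟩ y z
  have hf := cubic_ne_zero (δ := δ) c d
  obtain ⟨q, hq⟩ := mk_spec hf (toDiffPoly _ y * toDiffPoly _ z)
  rw [associator_eq hf hq, ha, mul_assoc, cubic_mul_const hδ, ← mul_assoc, mk_mul_self hf, neg_zero]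

theorem mul_ne_zero_of_ne_zero (hc : δ c = 0) (hδ : ∀ y, δ (δ (δ y)) = c * δ y) (hd : δ d ≠ 0)
    {x y : PetitAlgebra (cubic δ c d)} (hx : x ≠ 0) (hy : y ≠ 0) : x * y ≠ 0 := by
  intro h
  obtain ⟨q, hq⟩ := mk_spec (cubic_ne_zero c d) (toDiffPoly _ x * toDiffPoly _ y)
  rw [← mul_def, h, map_zero, add_zero] at hq
  refine mul_ne_mul_cubic hc hδ hd ?_ ?_ (toDiffPoly_natDegree_lt x) (toDiffPoly_natDegree_lt y) hq
  · exact fun h => hx (toDiffPoly_injective _ (h.trans (map_zero _).symm))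
  · exact fun h => hy (toDiffPoly_injective _ (h.trans (map_zero _).symm))

/-- Left and right multiplications are `F`-linear on a finite-dimensional space, so the absence of
zero divisors suffices. -/
theorem isDivisionAlg (hc : δ c = 0) (hδ : ∀ y, δ (δ (δ y)) = c * δ y) (hd : δ d ≠ 0)
    [Module.Finite (constField δ) (PetitAlgebra (cubic δ c d))]
    [Nontrivial (PetitAlgebra (cubic δ c d))] :
    IsDivisionAlg (PetitAlgebra (cubic δ c d)) := by
  refine ⟨inferInstance, fun a ha => ⟨?_, ?_⟩⟩
  · have h : Function.Injective (LinearMap.mulLeft (constField δ) a) := by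
      rw [injective_iff_map_eq_zero]
      intro x hx
      by_contra hx0
      exact mul_ne_zero_of_ne_zero hc hδ hd ha hx0 hx
    exact ⟨h, LinearMap.injective_iff_surjective.mp h⟩
  · have h : Function.Injective (LinearMap.mulRight (constField δ) a) := by
      rw [injective_iff_map_eq_zero]
      intro x hx
      by_contra hx0
      exact mul_ne_zero_of_ne_zero hc hδ hd hx0 ha hx
    exact ⟨h, LinearMap.injective_iff_surjective.mp h⟩

/-- The automorphism of `S_f` induced by `G_{id, b}`. -/
noncomputable def translateAut {b : K} (hb : b ^ 3 + δ (δ b) - c * b = 0) :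
    algAut (constField δ) (PetitAlgebra (cubic δ c d)) where
  val :=
    { toFun := translateRemainder b
      invFun := translateRemainder (-b)
      left_inv := fun x => toDiffPoly_injective _ (by
        rw [toDiffPoly_translateRemainder, toDiffPoly_translateRemainder, DiffPoly.translate_translate,
          neg_add_cancel, DiffPoly.translate_zero])
      right_inv := fun x => toDiffPoly_injective _ (by
        rw [toDiffPoly_translateRemainder, toDiffPoly_translateRemainder, DiffPoly.translate_translate,
          add_neg_cancel, DiffPoly.translate_zero])
      map_add' := fun x y => toDiffPoly_injective _ (by
        simp only [toDiffPoly_translateRemainder, map_add, DiffPoly.translate_add])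
      map_mul' := fun x y => by
        obtain ⟨q, hq⟩ := mk_spec (cubic_ne_zero c d) (toDiffPoly _ x * toDiffPoly _ y)
        -- Translating `x y = q f + r` fixes `f`, so the translate of `r` is the remainder of the
        -- translated product by uniqueness.
        have h := congrArg (DiffPoly.translate b) hq
        rw [DiffPoly.translate_add, DiffPoly.translate_mul, DiffPoly.translate_mul, translate_cubic hb] at h
        rw [mul_def _ (translateRemainder b x)]
        exact (modR_eq (cubic_ne_zero c d) h).symm }
  property a x := toDiffPoly_injective _ (by
    show DiffPoly.translate b ((a : K) • toDiffPoly _ x) = (a : K) • translate b (toDiffPoly _ x)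
    rw [← const_mul, translate_const_mul, const_mul])

theorem isTranslation_translateAut {b : K} (hb : b ^ 3 + δ (δ b) - c * b = 0) :
    IsTranslation (cubic δ c d) b (translateAut (d := d) hb :
      algAut (constField δ) (PetitAlgebra (cubic δ c d))) := fun _ => rfl

/-- The homomorphism `a ↦ G_{id, -a}` from the group of logarithmic derivatives to the
automorphism group of `S_f`. -/
noncomputable def translateAutHom (hδ : ∀ y, δ (δ (δ y)) = c * δ y) :
    Multiplicative (logDerivatives δ) →* algAut (constField δ) (PetitAlgebra (cubic δ c d)) :=
  have hV : ∀ a : logDerivatives δ, (-(a : K)) ^ 3 + δ (δ (-(a : K))) - c * (-(a : K)) = 0 := by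
    rintro ⟨_, b, hb, rfl⟩
    exact cubicNorm_neg (cubicNorm_logDerivative hδ hb)
  MonoidHom.mk' (fun a => translateAut (hV a.toAdd)) fun a b => Subtype.ext <| by
    refine (isTranslation_translateAut _).unique ?_
    have h := (isTranslation_translateAut (d := d) (hV a.toAdd)).mul
      (isTranslation_translateAut (hV b.toAdd))
    rwa [← neg_add] at h

theorem isTranslation_translateAutHom (hδ : ∀ y, δ (δ (δ y)) = c * δ y) (a : logDerivatives δ) :
    IsTranslation (cubic δ c d) (-(a : K))
      (translateAutHom (d := d) hδ (Multiplicative.ofAdd a) :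
        algAut (constField δ) (PetitAlgebra (cubic δ c d))) := fun _ => rfl

theorem translateAutHom_injective (hδ : ∀ y, δ (δ (δ y)) = c * δ y) :
    Function.Injective (translateAutHom (d := d) hδ) := by
  intro a b h
  have h1 := isTranslation_translateAutHom (d := d) hδ a.toAdd
  rw [ofAdd_toAdd, h] at h1
  exact Subtype.ext (neg_injective
    (h1.parameter_unique (isTranslation_translateAutHom (d := d) hδ b.toAdd)))

end Cubic

end PetitAlgebra

theorem mainTheorem6 {K : Type*} [Field K] [CharP K 3] (δ : Derivation ℤ K K)
    (c : constField δ)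
    (hδ : minpoly (constField δ) (derivationEnd δ) = X ^ 3 - C c * X)
    (d : K) (hd : d ∉ constField δ)
    (f : DiffPoly δ)
    (hf : f = DiffPoly.t δ ^ 3 - DiffPoly.const δ c * DiffPoly.t δ - DiffPoly.const δ d) :
    Module.finrank (constField δ) (PetitAlgebra f) = 9 ∧
    (¬ ∀ x y z : PetitAlgebra f, x * y * z = x * (y * z)) ∧
    IsDivisionAlg (PetitAlgebra f) ∧
    leftNucleus (PetitAlgebra f) = PetitAlgebra.constants f ∧
    middleNucleus (PetitAlgebra f) = PetitAlgebra.constants f ∧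
    PetitAlgebra.constants f ⊆ rightNucleus (PetitAlgebra f) ∧
    (logDerivatives δ : Set K) = {a | a ^ 3 + δ (δ a) - c * a = 0} ∧
    (∀ a : K, a ^ 3 + δ (δ a) - c * a = 0 →
      ∃ σ : algAut (constField δ) (PetitAlgebra f), PetitAlgebra.IsTranslation f (-a) σ) ∧
    ∃ H : Subgroup (algAut (constField δ) (PetitAlgebra f)),
      (∀ σ : algAut (constField δ) (PetitAlgebra f), σ ∈ H ↔
        ∃ a : K, a ^ 3 + δ (δ a) - c * a = 0 ∧ PetitAlgebra.IsTranslation f (-a) σ) ∧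
      ∃ φ : Multiplicative (logDerivatives δ) ≃* H, ∀ a : logDerivatives δ,
        PetitAlgebra.IsTranslation f (-(a : K))
          (φ (Multiplicative.ofAdd a) : algAut (constField δ) (PetitAlgebra f)) := by
  obtain rfl : f = DiffPoly.cubic δ c d := hf
  have hc : δ (c : K) = 0 := c.2
  have hd' : δ d ≠ 0 := hd
  have hδ' := derivation_cube_eq hδ
  have hrank : Module.finrank (constField δ) (PetitAlgebra (DiffPoly.cubic δ (c : K) d)) = 9 := by
    -- Tower law: `[K : F] = 3`, and `S_f` has dimension `deg f = 3` over `K`.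
    rw [← Module.finrank_mul_finrank (constField δ) K, finrank_constField hδ hδ' hd',
      PetitAlgebra.finrank_eq_natDegree, DiffPoly.natDegree_cubic]
  have : Module.Finite (constField δ) (PetitAlgebra (DiffPoly.cubic δ (c : K) d)) :=
    Module.finite_of_finrank_pos (by rw [hrank]; norm_num)
  have : Nontrivial (PetitAlgebra (DiffPoly.cubic δ (c : K) d)) :=
    Module.nontrivial_of_finrank_pos (R := constField δ) (by rw [hrank]; norm_num)
  have hlog : (logDerivatives δ : Set K) = {a | a ^ 3 + δ (δ a) - c * a = 0} := by
    ext a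
    refine ⟨?_, exists_logDerivative_eq hc hδ' hd'⟩
    rintro ⟨b, hb, rfl⟩
    exact cubicNorm_logDerivative hδ' hb
  refine ⟨hrank, PetitAlgebra.not_associative hc hd', PetitAlgebra.isDivisionAlg hc hδ' hd',
    PetitAlgebra.leftNucleus_eq hc hd', PetitAlgebra.middleNucleus_eq hc hd',
    PetitAlgebra.constants_subset_rightNucleus hδ', hlog,
    fun a ha => ⟨_, PetitAlgebra.isTranslation_translateAut (cubicNorm_neg ha)⟩,
    (PetitAlgebra.translateAutHom hδ').range, fun σ => ⟨?_, ?_⟩,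
    MonoidHom.ofInjective (PetitAlgebra.translateAutHom_injective hδ'),
    PetitAlgebra.isTranslation_translateAutHom hδ'⟩
  · rintro ⟨a, rfl⟩
    exact ⟨(a.toAdd : K), hlog.subset a.toAdd.2,
      PetitAlgebra.isTranslation_translateAutHom hδ' a.toAdd⟩
  · rintro ⟨a, ha, hσ⟩
    exact ⟨Multiplicative.ofAdd ⟨a, hlog.superset ha⟩, Subtype.ext
      ((PetitAlgebra.isTranslation_translateAutHom hδ' ⟨a, hlog.superset ha⟩).unique hσ)⟩
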